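/- Let $d\ge 2$ and $\lambda>0$ with $\lambda\nu_d>1$, where $\nu_d$ is the volume of the unit Euclidean ball in $\mathbb R^d$. Then there is a constant $\widetilde\delta>0$, depending only on $\lambda$ and $d$, such that the following holds for all constants $\chi>0$ with $$1-\tfrac32\sqrt d\,\chi^{1/d}>0,\qquad \nu_d\Big(1-\tfrac32\sqrt d\,\chi^{1/d}\Big)^d\ \ge\ \tfrac12\Big(\nu_d+\tfrac1\lambda\Big),\qquad \chi<\tfrac12\Big(\nu_d-\tfrac1\lambda\Big),$$ and all constants $\delta$ with $$0<\delta<\frac{\widetilde\delta\,\chi}{\nu_d R_d^{\,d}},\qquad R_d=1-\tfrac12\sqrt d\,\chi^{1/d}.$$ For real $n>0$ let $\mathcal S_{d,n}=[-n^{1/d}/2,\,n^{1/d}/2]^d$, equipped with the toroidal metric: $\|x-y\|$ is the Euclidean norm of the vector with coordinates $\min\{|x_i-y_i|,\,n^{1/d}-|x_i-y_i|\}$. Let $V_n\subset\mathcal S_{d,n}$ be a homogeneous Poisson point process of intensity $\lambda$ on $\mathcal S_{d,n}$. Let $m_n$ be natural numbers with $n/m_n^d=(1+o(1))\,\chi\log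 n$ as $n\to\infty$, and partition $\mathcal S_{d,n}$ into $m_n^d$ congruent cubic blocks, so that each block has volume $n/m_n^d$ (exactly $\chi\log n$ for those $n$ for which $m_n^d=n/(\chi\log n)$). Let $H_n$, the $(\chi,\delta)$-visibility graph, be the graph whose vertices are the blocks containing at least $\delta\log n$ points of $V_n$, two distinct such blocks $B,B'$ being adjacent if and only if $\sup_{x\in B,\,y\in B'}\|x-y\|\le(\log n)^{1/d}$. Then $$\mathbb P(H_n\text{ is connected})\longrightarrow 1\qquad\text{as } n\to\infty$$ (in particular $H_n$ is non-empty with probability tending to $1$). -/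

import Mathlib

open MeasureTheory ProbabilityTheory Filter Topology
open scoped ENNReal

/-- The volume `ν_d` of the Euclidean unit ball of `ℝ^d`. -/
noncomputable def unitBallVolume (d : ℕ) : ℝ :=
  (volume (Metric.ball (0 : EuclideanSpace ℝ (Fin d)) 1)).toReal

/-- The side length `n^{1/d}` of the cube of volume `n`. -/
noncomputable def sideLength (d : ℕ) (n : ℝ) : ℝ := n ^ (1 / (d : ℝ))

/-- The region `[-n^{1/d}/2, n^{1/d}/2]^d`. -/
def region (d : ℕ) (n : ℝ) : Set (EuclideanSpace ℝ (Fin d)) :=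
  {x | ∀ i, -(sideLength d n / 2) ≤ x i ∧ x i ≤ sideLength d n / 2}

/-- The toroidal metric on the region: the Euclidean norm of the vector with coordinates
`min {|x_i - y_i|, n^{1/d} - |x_i - y_i|}`. -/
noncomputable def torusDist {d : ℕ} (n : ℝ) (x y : EuclideanSpace ℝ (Fin d)) : ℝ :=
  √(∑ i, (min |x i - y i| (sideLength d n - |x i - y i|)) ^ 2)

theorem torusDist_comm {d : ℕ} (n : ℝ) (x y : EuclideanSpace ℝ (Fin d)) :
    torusDist n x y = torusDist n y x := by
  simp only [torusDist, abs_sub_comm]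

/-- The block with index `k` in the partition of the region into `m^d` congruent cubes. Blocks are
half-open, except that the last block in each direction contains its upper face, so that the
blocks partition the closed region exactly. -/
def block (d : ℕ) (n : ℝ) (m : ℕ) (k : Fin d → Fin m) : Set (EuclideanSpace ℝ (Fin d)) :=
  {x | ∀ i,
    -(sideLength d n / 2) + (k i : ℕ) * (sideLength d n / m) ≤ x i ∧
      (x i < -(sideLength d n / 2) + ((k i : ℕ) + 1) * (sideLength d n / m) ∨
        ((k i : ℕ) + 1 = m ∧ x i = sideLength d n / 2))}

/-- Two sets `A`, `B` are mutually visible if `sup_{x ∈ A, y ∈ B} ‖x - y‖ ≤ (log n)^{1/d}` in the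
toroidal metric. -/
def MutuallyVisible {d : ℕ} (n : ℝ) (A B : Set (EuclideanSpace ℝ (Fin d))) : Prop :=
  ∀ x ∈ A, ∀ y ∈ B, torusDist n x y ≤ (Real.log n) ^ (1 / (d : ℝ))

/-- A block with at least `δ log n` points of `V`. -/
def OccupiedBlock (d : ℕ) (n : ℝ) (m : ℕ) (δ : ℝ) (V : Set (EuclideanSpace ℝ (Fin d)))
    (k : Fin d → Fin m) : Prop :=
  ENNReal.ofReal (δ * Real.log n) ≤ ((V ∩ block d n m k).encard : ℝ≥0∞)

/-- The visibility graph of the point set `V`: its vertices are the occupied blocks of the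
partition into `m^d` cubes; two distinct occupied blocks are joined if they are mutually visible. -/
def visibilityGraph (d : ℕ) (n : ℝ) (m : ℕ) (δ : ℝ) (V : Set (EuclideanSpace ℝ (Fin d))) :
    SimpleGraph {k : Fin d → Fin m // OccupiedBlock d n m δ V k} where
  Adj i j := i ≠ j ∧ MutuallyVisible n (block d n m i.1) (block d n m j.1)
  symm := ⟨fun _ _ h => ⟨h.1.symm, fun x hx y hy => by
    rw [torusDist_comm]; exact h.2 y hy x hx⟩⟩
  loopless := ⟨fun _ h => h.1 rfl⟩

/-- `V` is a homogeneous Poisson point process with intensity `lam` on `S`: a random countable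
subset of `S` whose number of points in a bounded Borel set `B` is Poisson with mean
`lam * vol (B ∩ S)`, with independent counts in disjoint Borel sets. -/
structure IsPoissonPointProcess {Ω : Type*} [MeasurableSpace Ω] {d : ℕ} (P : Measure Ω)
    (S : Set (EuclideanSpace ℝ (Fin d))) (lam : ℝ)
    (V : Ω → Set (EuclideanSpace ℝ (Fin d))) : Prop where
  countable : ∀ ω, (V ω).Countable
  subset : ∀ ω, V ω ⊆ S
  measurable_count : ∀ B, MeasurableSet B → Measurable fun ω => (V ω ∩ B).encard
  law_count : ∀ B, MeasurableSet B → Bornology.IsBounded B →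
    P.map (fun ω => (V ω ∩ B).encard) =
      (poissonMeasure (lam * (volume (B ∩ S)).toReal).toNNReal).map (fun j : ℕ => (j : ℕ∞))
  indep_count : ∀ (k : ℕ) (B : Fin k → Set (EuclideanSpace ℝ (Fin d))),
    (∀ j, MeasurableSet (B j)) → Pairwise (fun i j => Disjoint (B i) (B j)) →
    iIndepFun (fun j ω => (V ω ∩ B j).encard) P

/-- The conditions on the block volume parameter `χ` for `d ≥ 2`. The positivity of
`1 - 3√d χ^{1/d}/2` says that the smallness branch of the inequality after it is meant: for even
`d` that inequality also holds for some large `χ`. -/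
structure ChiAdmissible (d : ℕ) (lam χ : ℝ) : Prop where
  pos : 0 < χ
  base_pos : 0 < 1 - 3 * √(d : ℝ) * χ ^ (1 / (d : ℝ)) / 2
  volume_bound : (unitBallVolume d + 1 / lam) / 2 ≤
    unitBallVolume d * (1 - 3 * √(d : ℝ) * χ ^ (1 / (d : ℝ)) / 2) ^ d
  lt_half : χ < (unitBallVolume d - 1 / lam) / 2

/-- The normalised radius `R_d = 1 - √d χ^{1/d}/2`. -/
noncomputable def visRadius (d : ℕ) (χ : ℝ) : ℝ :=
  1 - √(d : ℝ) * χ ^ (1 / (d : ℝ)) / 2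

/-! Lift the blocks of the torus periodically to `ℤ^d` and call a lattice point closed if its block
is not occupied. With `ρ = χ^(-1/d)`, blocks whose offset lies in the finite set `N = visSteps d ρ`
see each other for large `n`. Put `K = |N| - 1`. The proof shows that, with high probability, no box
of a fixed size contains `K` closed points, and that this alone forces connectedness.

Deterministic part (`lattice_connected`): fewer than `K` closed points in a box leave one of any `K`
consecutive slices of it fully open. Open slices in different directions meet, and overlapping boxes
share one, so all open slices belong to one component. A component avoiding them is trapped between
open slices, since `N` is solid and a step cannot jump over a slice without offering a step onto it.
Such a component `C` is finite, and Cauchy–Davenport in `ℤ^d` gives `|(C + N) \ C| ≥ |N| - 1 = K`.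
All these points are closed and lie in one box, a contradiction.

Probabilistic part: up to a small loss in the exponent, a block is closed with probability at most
`n^(-λχ)`, independently for distinct blocks, so `K` given blocks are closed with probability about
`n^(-λχK)`. There are at most `n` box positions on the torus and boundedly many `K`-subsets per box.
A volume comparison gives `λχK ≥ 1 + (λν_d - 1)/3` (`ChiAdmissible.card_bound`), which makes the
union bound vanish and leaves room for a positive `δ`. -/

/-! ### Connectivity of integer boxes -/

theorem Pi.mem_Icc_int {d : ℕ} {a b p : Fin d → ℤ} :
    p ∈ Set.Icc a b ↔ ∀ i, a i ≤ p i ∧ p i ≤ b i :=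
  ⟨fun h i => ⟨h.1 i, h.2 i⟩, fun h => ⟨fun i => (h i).1, fun i => (h i).2⟩⟩

/-- A reflexive, symmetric and transitive relation that relates lattice points of a box
differing by a unit vector relates all lattice points of the box. -/
theorem box_connected {d : ℕ} {a b : Fin d → ℤ} {Q : (Fin d → ℤ) → (Fin d → ℤ) → Prop}
    (hrefl : ∀ p, Q p p) (hsymm : ∀ p q, Q p q → Q q p)
    (htrans : ∀ p q r, Q p q → Q q r → Q p r)
    (hstep : ∀ p k, p ∈ Set.Icc a b → p + Pi.single k 1 ∈ Set.Icc a b → Q p (p + Pi.single k 1))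
    {p q : Fin d → ℤ} (hp : p ∈ Set.Icc a b) (hq : q ∈ Set.Icc a b) : Q p q := by
  -- Induction on the `ℓ¹` distance: moving one coordinate of `p` towards `q` stays in the box.
  induction hn : ∑ i, (p i - q i).natAbs using Nat.strong_induction_on generalizing p with
  | _ n ih =>
    by_cases hpq : p = q
    · subst hpq; exact hrefl p
    obtain ⟨i, hi⟩ := Function.ne_iff.1 hpq
    have key : ∀ e : ℤ, p i + e ∈ Set.Icc (a i) (b i) → (p i + e - q i).natAbs < (p i - q i).natAbs →
        p + Pi.single i e ∈ Set.Icc a b ∧ Q (p + Pi.single i e) q := by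
      intro e he hlt
      have hmem : p + Pi.single i e ∈ Set.Icc a b := by
        constructor <;> intro j <;> by_cases hj : j = i
        · subst hj; simpa using he.1
        · simpa [hj] using hp.1 j
        · subst hj; simpa using he.2
        · simpa [hj] using hp.2 j
      refine ⟨hmem, ih _ ?_ hmem rfl⟩
      rw [← hn]
      refine Finset.sum_lt_sum (fun j _ => ?_) ⟨i, Finset.mem_univ _, by simpa using hlt⟩
      by_cases hj : j = i
      · subst hj; simpa using hlt.le
      · simp [hj]
    have h1 := Pi.mem_Icc_int.1 hp i
    have h2 := Pi.mem_Icc_int.1 hq i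
    rcases lt_or_gt_of_ne hi with h | h
    · obtain ⟨hm, hQ⟩ := key 1 ⟨by omega, by omega⟩ (by omega)
      exact htrans _ _ _ (hstep p i hp hm) hQ
    · obtain ⟨hm, hQ⟩ := key (-1) ⟨by omega, by omega⟩ (by omega)
      have he : p + Pi.single i (-1) + Pi.single i 1 = p := by
        rw [add_assoc, ← Pi.single_add]; simp
      have := hstep _ i hm (by rwa [he])
      rw [he] at this
      exact htrans _ _ _ (hsymm _ _ this) hQ

/-! ### Connectivity of lattice sets with few closed points per box -/

/-- A step from `x` to `y` within `O` by a vector of `N`. -/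
def LatticeStep {d : ℕ} (N : Finset (Fin d → ℤ)) (O : Set (Fin d → ℤ)) (x y : Fin d → ℤ) : Prop :=
  x ∈ O ∧ y ∈ O ∧ y - x ∈ N

/-- The points `x` and `y` are joined by a path within `O` with steps in `N`. -/
abbrev LatticeConn {d : ℕ} (N : Finset (Fin d → ℤ)) (O : Set (Fin d → ℤ)) :
    (Fin d → ℤ) → (Fin d → ℤ) → Prop :=
  Relation.ReflTransGen (LatticeStep N O)

/-- A set of vectors that is closed under decreasing coordinates in absolute value. -/
def IsSolidSet {d : ℕ} (N : Finset (Fin d → ℤ)) : Prop :=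
  ∀ v ∈ N, ∀ w : Fin d → ℤ, (∀ i, |w i| ≤ |v i|) → w ∈ N

/-- The slice `{w | w i = c}` of the box `[a, b]` is contained in `O`. -/
def OpenSlice {d : ℕ} (O : Set (Fin d → ℤ)) (a b : Fin d → ℤ) (i : Fin d) (c : ℤ) : Prop :=
  ∀ w ∈ Set.Icc a b, w i = c → w ∈ O

/-- The point `p` lies on an open slice of the box `[a, b]`. -/
def OnOpenSlice {d : ℕ} (O : Set (Fin d → ℤ)) (a b p : Fin d → ℤ) : Prop :=
  p ∈ Set.Icc a b ∧ ∃ i, OpenSlice O a b i (p i)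

section Lattice

open scoped Pointwise

variable {d : ℕ} {N : Finset (Fin d → ℤ)} {O : Set (Fin d → ℤ)} {a b : Fin d → ℤ}

theorem LatticeConn.symm (hN : IsSolidSet N) {x y : Fin d → ℤ} (h : LatticeConn N O x y) :
    LatticeConn N O y x := by
  have : Std.Symm (LatticeStep N O) := ⟨fun u v huv => ⟨huv.2.1, huv.1,
    hN _ huv.2.2 _ fun i => by simp [abs_sub_comm]⟩⟩
  exact Relation.ReflTransGen.stdSymm.symm _ _ h

theorem update_mem_Icc {p : Fin d → ℤ} (hp : p ∈ Set.Icc a b) {i : Fin d} {c : ℤ}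
    (hc : c ∈ Set.Icc (a i) (b i)) : Function.update p i c ∈ Set.Icc a b := by
  constructor <;> intro j <;> by_cases hj : j = i
  · subst hj; simpa using hc.1
  · simpa [hj] using hp.1 j
  · subst hj; simpa using hc.2
  · simpa [hj] using hp.2 j

/-- Pigeonhole: each non-open slice contains a closed point, and a point lies on only one slice in
direction `i`. Slices outside the box are vacuously open, so the range of `u` has to be controlled
where this is used. -/
theorem exists_openSlice {K : ℕ} (hcount : (Set.Icc a b \ O).ncard < K) (i : Fin d) (u : ℤ) :
    ∃ c, u ≤ c ∧ c < u + K ∧ OpenSlice O a b i c := by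
  by_contra! hcon
  have hsub : Set.Ico u (u + K) ⊆ (fun w : Fin d → ℤ => w i) '' (Set.Icc a b \ O) := by
    intro c hc
    have := hcon c hc.1 hc.2
    simp only [OpenSlice, not_forall] at this
    obtain ⟨w, hw, hwc, hwO⟩ := this
    exact ⟨w, ⟨hw, hwO⟩, hwc⟩
  have hfin : (Set.Icc a b \ O).Finite := (Set.finite_Icc a b).sdiff
  have h1 := Set.ncard_le_ncard hsub (hfin.image _)
  have h2 := Set.ncard_image_le (f := fun w : Fin d → ℤ => w i) hfin
  have h3 : (Set.Ico u (u + K)).ncard = K := by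
    rw [← Finset.coe_Ico, Set.ncard_coe_finset]; simp
  omega

/-- A slice is itself a box, degenerate in direction `i`, so unit steps inside it suffice. -/
theorem OpenSlice.conn (hN : IsSolidSet N) (hunit : ∀ i, Pi.single i 1 ∈ N) {i : Fin d} {c : ℤ}
    (h : OpenSlice O a b i c) {p q : Fin d → ℤ} (hp : p ∈ Set.Icc a b) (hq : q ∈ Set.Icc a b)
    (hpc : p i = c) (hqc : q i = c) : LatticeConn N O p q := by
  have hmem : ∀ w, w ∈ Set.Icc (Function.update a i c) (Function.update b i c) ↔
      w ∈ Set.Icc a b ∧ w i = c := by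
    intro w
    constructor
    · intro hw
      have hwi : w i = c := le_antisymm (by simpa using hw.2 i) (by simpa using hw.1 i)
      refine ⟨⟨fun j => ?_, fun j => ?_⟩, hwi⟩ <;> by_cases hj : j = i
      · subst hj; rw [hwi, ← hpc]; exact hp.1 j
      · simpa [hj] using hw.1 j
      · subst hj; rw [hwi, ← hpc]; exact hp.2 j
      · simpa [hj] using hw.2 j
    · rintro ⟨hw, hwi⟩
      refine ⟨fun j => ?_, fun j => ?_⟩ <;> by_cases hj : j = i
      · subst hj; simp [hwi]
      · simpa [hj] using hw.1 j
      · subst hj; simp [hwi]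
      · simpa [hj] using hw.2 j
  refine box_connected (Q := LatticeConn N O) (fun _ => Relation.ReflTransGen.refl)
    (fun _ _ h => h.symm hN) (fun _ _ _ h h' => h.trans h') (fun r k hr hr' => ?_)
    ((hmem p).2 ⟨hp, hpc⟩) ((hmem q).2 ⟨hq, hqc⟩)
  obtain ⟨h1, h2⟩ := (hmem _).1 hr
  obtain ⟨h3, h4⟩ := (hmem _).1 hr'
  exact Relation.ReflTransGen.single ⟨h _ h1 h2, h _ h3 h4, by simpa using hunit k⟩

theorem OnOpenSlice.mem {p : Fin d → ℤ} (h : OnOpenSlice O a b p) : p ∈ O := by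
  obtain ⟨hp, i, hi⟩ := h
  exact hi p hp rfl

/-- Slices in different directions intersect. Two parallel ones are linked through an open slice in
another direction, which needs `2 ≤ d`. -/
theorem OnOpenSlice.conn (hd : 2 ≤ d) (hN : IsSolidSet N) (hunit : ∀ i, Pi.single i 1 ∈ N) {K : ℕ}
    (hcount : (Set.Icc a b \ O).ncard < K) (hK : ∀ i, a i + K ≤ b i + 1) {p q : Fin d → ℤ}
    (hp : OnOpenSlice O a b p) (hq : OnOpenSlice O a b q) : LatticeConn N O p q := by
  have cross : ∀ i j, i ≠ j → ∀ p q, p ∈ Set.Icc a b → q ∈ Set.Icc a b →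
      OpenSlice O a b i (p i) → OpenSlice O a b j (q j) → LatticeConn N O p q := by
    intro i j hij p q hp hq hi hj
    have hm := update_mem_Icc hp (i := j) (c := q j) ⟨hq.1 j, hq.2 j⟩
    exact (hi.conn hN hunit hp hm rfl (by simp [hij])).trans
      (hj.conn hN hunit hm hq (by simp) rfl)
  obtain ⟨hp, i, hi⟩ := hp
  obtain ⟨hq, j, hj⟩ := hq
  by_cases hij : i = j
  · subst hij
    have : Nontrivial (Fin d) := Fin.nontrivial_iff_two_le.2 hd
    obtain ⟨k, hk⟩ := exists_ne i
    obtain ⟨c, hc1, hc2, hc⟩ := exists_openSlice hcount k (a k)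
    have hm := update_mem_Icc hp (i := k) (c := c) ⟨hc1, by have := hK k; omega⟩
    have hs : OpenSlice O a b k (Function.update p k c k) := by simpa using hc
    exact (cross i k hk.symm _ _ hp hm hi hs).trans (cross k i hk _ _ hm hq hs hj)
  · exact cross i j hij p q hp hq hi hj

theorem OpenSlice.mono {a' b' : Fin d → ℤ} (ha : a ≤ a') (hb : b' ≤ b) {i : Fin d} {c : ℤ}
    (h : OpenSlice O a b i c) : OpenSlice O a' b' i c :=
  fun w hw hwc => h w ⟨ha.trans hw.1, hw.2.trans hb⟩ hwc

/-- Points on open slices of two boxes of the same size whose corners differ by a unit vector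
are connected. -/
theorem OnOpenSlice.conn_of_shift (hd : 2 ≤ d) (hN : IsSolidSet N)
    (hunit : ∀ i, Pi.single i 1 ∈ N) {K : ℕ} {M : ℤ} (hKM : K ≤ M) (hM : 0 < M)
    (hcount : ∀ z, (Set.Icc z (z + fun _ => M + 1) \ O).ncard < K) (z : Fin d → ℤ) (k : Fin d)
    {p q : Fin d → ℤ} (hp : OnOpenSlice O z (z + fun _ => M) p)
    (hq : OnOpenSlice O (z + Pi.single k 1) (z + Pi.single k 1 + fun _ => M) q) :
    LatticeConn N O p q := by
  have hcount' : ∀ z, (Set.Icc z (z + fun _ => M) \ O).ncard < K := fun z =>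
    (Set.ncard_le_ncard (Set.sdiff_subset_sdiff_left
      (Set.Icc_subset_Icc_right fun i => by simp)) (Set.finite_Icc _ _).sdiff).trans_lt (hcount z)
  have hs : (0 : Fin d → ℤ) ≤ Pi.single k 1 := by
    intro j; by_cases hj : j = k
    · subst hj; simp
    · simp [hj]
  have hs' : Pi.single k 1 ≤ (1 : Fin d → ℤ) := by
    intro j; by_cases hj : j = k
    · subst hj; simp
    · simp [hj]
  -- The box of side `M + 1` contains both boxes. Starting the search at `z k + 1` puts the open
  -- slice inside both, because `K ≤ M`.
  obtain ⟨c, hc1, hc2, hc⟩ := exists_openSlice (hcount z) k (z k + 1)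
  set r : Fin d → ℤ := Function.update (z + Pi.single k 1) k c with hr
  have hrk : r k = c := by simp [hr]
  have hrj : ∀ j, j ≠ k → r j = z j := fun j hj => by simp [hr, hj]
  have h1 : OnOpenSlice O z (z + fun _ => M) r := by
    refine ⟨Pi.mem_Icc_int.2 fun j => ?_, k, ?_⟩
    · simp only [Pi.add_apply]
      by_cases hj : j = k
      · subst hj; omega
      · rw [hrj j hj]; omega
    · rw [hrk]; exact hc.mono le_rfl fun j => by simp
  have h2 : OnOpenSlice O (z + Pi.single k 1) (z + Pi.single k 1 + fun _ => M) r := by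
    refine ⟨Pi.mem_Icc_int.2 fun j => ?_, k, ?_⟩
    · simp only [Pi.add_apply]
      by_cases hj : j = k
      · subst hj; rw [Pi.single_eq_same]; omega
      · rw [hrj j hj, Pi.single_eq_of_ne hj]; omega
    · rw [hrk]
      refine hc.mono (fun j => ?_) fun j => ?_
      · simpa using hs j
      · have := hs' j
        simp only [Pi.add_apply, Pi.one_apply] at this ⊢
        omega
  have hK : ∀ z : Fin d → ℤ, ∀ i, z i + K ≤ (z + fun _ => M : Fin d → ℤ) i + 1 := fun z i => by
    simp only [Pi.add_apply]; omega
  exact (hp.conn hd hN hunit (hcount' _) (hK _) h1).trans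
    (h2.conn hd hN hunit (hcount' _) (hK _) hq)

/-- The connected component of a point that is not connected to the open slices of a large box
around it stays in a bounded box, so that its boundary would have too many closed points. -/
theorem exists_onOpenSlice_conn (hN : IsSolidSet N)
    (hunit : ∀ i, Pi.single i 1 ∈ N) {D : ℤ} (hD : ∀ v ∈ N, ∀ i, |v i| ≤ D) {K : ℕ}
    (hK : K + 1 = N.card) {x : Fin d → ℤ} (hx : x ∈ O)
    (hcount : (Set.Icc (x - fun _ => K + D) (x + fun _ => K + D) \ O).ncard < K) :
    ∃ p, OnOpenSlice O (x - fun _ => K + D) (x + fun _ => K + D) p ∧ LatticeConn N O x p := by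
  classical
  by_contra! hcon
  set a : Fin d → ℤ := x - fun _ => K + D with ha
  set b : Fin d → ℤ := x + fun _ => K + D with hb
  have hai : ∀ i, a i = x i - (K + D) := fun i => rfl
  have hbi : ∀ i, b i = x i + (K + D) := fun i => rfl
  have hD0 : ∀ i : Fin d, 0 < D := fun i => by
    have := hD _ (hunit i) i
    simp at this; omega
  have up : ∀ i, ∃ c, x i < c ∧ c ≤ x i + K ∧ OpenSlice O a b i c := by
    intro i
    obtain ⟨c, h1, h2, h3⟩ := exists_openSlice hcount i (x i + 1)
    exact ⟨c, by omega, by omega, h3⟩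
  have down : ∀ i, ∃ c, x i - K ≤ c ∧ c < x i ∧ OpenSlice O a b i c := by
    intro i
    obtain ⟨c, h1, h2, h3⟩ := exists_openSlice hcount i (x i - K)
    exact ⟨c, by omega, by omega, h3⟩
  choose cu hcu1 hcu2 hcu3 using up
  choose cd hcd1 hcd2 hcd3 using down
  -- The component of `x` never passes the open slices `cd i` and `cu i` found within distance `K`
  -- of `x`.
  have hconf : ∀ y, LatticeConn N O x y → y ∈ O ∧ ∀ i, cd i < y i ∧ y i < cu i := by
    intro y hy
    induction hy with
    | refl => exact ⟨hx, fun i => ⟨hcd2 i, hcu1 i⟩⟩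
    | @tail y w hxy hyw ih =>
      obtain ⟨hyO, hy⟩ := ih
      have hymem : y ∈ Set.Icc a b := by
        refine Pi.mem_Icc_int.2 fun i => ?_
        have := hy i; have := hcd1 i; have := hD0 i; have := hcu2 i
        rw [hai, hbi]; omega
      -- If the step from `y` to `w` reached or crossed the slice at `c`, moving only coordinate `i`
      -- of `y` to `c` would be a vector of `N` by solidity, and would join `x` to an open slice.
      have cross : ∀ i c, OpenSlice O a b i c → c ∈ Set.Icc (a i) (b i) →
          |c - y i| ≤ |w i - y i| → False := by
        intro i c hc hcm hle
        have hm := update_mem_Icc hymem hcm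
        have hO : Function.update y i c ∈ O := hc _ hm (by simp)
        refine hcon (Function.update y i c) ⟨hm, i, by simpa using hc⟩
          (hxy.tail ⟨hyO, hO, hN _ hyw.2.2 _ fun j => ?_⟩)
        by_cases hj : j = i
        · subst hj; simpa using hle
        · simp [hj]
      refine ⟨hyw.2.1, fun i => ?_⟩
      have h1 := hy i
      have h2 := hcd1 i
      have h3 := hcu2 i
      have h4 := hD0 i
      have h5 := hcu1 i
      have h6 := hcd2 i
      constructor
      · by_contra! hle
        refine cross i (cd i) (hcd3 i) ⟨by rw [hai]; omega, by rw [hbi]; omega⟩ ?_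
        rw [abs_of_nonpos (by omega), abs_of_nonpos (by omega)]; omega
      · by_contra! hle
        refine cross i (cu i) (hcu3 i) ⟨by rw [hai]; omega, by rw [hbi]; omega⟩ ?_
        rw [abs_of_nonneg (by omega), abs_of_nonneg (by omega)]; omega
  have hCfin : {y | LatticeConn N O x y}.Finite :=
    (Set.finite_Icc a b).subset fun y hy => by
      have h := (hconf y hy).2
      refine Pi.mem_Icc_int.2 fun i => ?_
      have := h i; have := hcd1 i; have := hD0 i; have := hcu2 i
      rw [hai, hbi]; omega
  set C := hCfin.toFinset with hC
  have hmemC : ∀ y, y ∈ C ↔ LatticeConn N O x y := fun y => by simp [hC]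
  have hCne : C.Nonempty := ⟨x, (hmemC x).2 Relation.ReflTransGen.refl⟩
  have hNne : N.Nonempty := Finset.card_pos.1 (by omega)
  have hcd := cauchy_davenport_of_isAddTorsionFree hCne hNne
  -- An open point of `C + N` would belong to `C`. The margin `D` in the box radius keeps `C + N`
  -- inside the box.
  have hsub : ((C + N) \ C : Finset (Fin d → ℤ)) ⊆ (Set.Icc a b \ O).toFinset := by
    intro w hw
    rw [Finset.mem_sdiff, Finset.mem_add] at hw
    obtain ⟨⟨y, hy, v, hv, rfl⟩, hw⟩ := hw
    have hy' := hconf y ((hmemC y).1 hy)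
    rw [Set.mem_toFinset]
    refine ⟨Pi.mem_Icc_int.2 fun i => ?_, fun hO => hw ?_⟩
    · have := hy'.2 i; have := hcd1 i; have := hcu2 i; have := abs_le.1 (hD v hv i)
      rw [hai, hbi, Pi.add_apply]; omega
    · exact (hmemC _).2 (((hmemC y).1 hy).tail ⟨hy'.1, hO, by simpa using hv⟩)
  have h1 := Finset.card_le_card hsub
  rw [← Set.ncard_eq_toFinset_card'] at h1
  have h2 := Finset.le_card_sdiff C (C + N)
  have h3 := Finset.card_pos.2 hCne
  omega

/-- If every box of a suitable size contains fewer than `|N| - 1` points outside of `O`, then `O`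
is nonempty and connected under steps in `N`. -/
theorem lattice_connected (hd : 2 ≤ d) (hN : IsSolidSet N)
    (hunit : ∀ i, Pi.single i 1 ∈ N) {D : ℤ} (hD : ∀ v ∈ N, ∀ i, |v i| ≤ D) {K : ℕ}
    (hK : K + 1 = N.card)
    (hcount : ∀ z, (Set.Icc z (z + fun _ => 2 * (K + D) + 1) \ O).ncard < K) :
    O.Nonempty ∧ ∀ x ∈ O, ∀ y ∈ O, LatticeConn N O x y := by
  have hD0 : 0 < D := by
    have := hD _ (hunit ⟨0, by omega⟩) ⟨0, by omega⟩
    simp at this; omega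
  set M : ℤ := 2 * (K + D) with hM
  have hcount' : ∀ z, (Set.Icc z (z + fun _ => M) \ O).ncard < K := fun z =>
    (Set.ncard_le_ncard (Set.sdiff_subset_sdiff_left
      (Set.Icc_subset_Icc_right fun i => by simp)) (Set.finite_Icc _ _).sdiff).trans_lt (hcount z)
  have hKM : ∀ z : Fin d → ℤ, ∀ i, z i + K ≤ (z + fun _ => M : Fin d → ℤ) i + 1 := fun z i => by
    simp only [Pi.add_apply]; omega
  have hex : ∀ z, ∃ p, OnOpenSlice O z (z + fun _ => M) p := by
    intro z
    obtain ⟨c, h1, h2, h3⟩ := exists_openSlice (hcount' z) ⟨0, by omega⟩ (z ⟨0, by omega⟩)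
    refine ⟨Function.update z ⟨0, by omega⟩ c, update_mem_Icc (Pi.mem_Icc_int.2 fun i => ?_) ⟨h1, ?_⟩,
      ⟨0, by omega⟩, by simpa using h3⟩
    · simp only [Pi.add_apply]; omega
    · have := hKM z ⟨0, by omega⟩; omega
  choose rep hrep using hex
  -- Here `box_connected` moves the corner of the box, not a point of `O`.
  have hall : ∀ z z', LatticeConn N O (rep z) (rep z') := fun z z' =>
    box_connected (a := z ⊓ z') (b := z ⊔ z') (Q := fun z z' => LatticeConn N O (rep z) (rep z'))
      (fun _ => Relation.ReflTransGen.refl) (fun _ _ h => h.symm hN)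
      (fun _ _ _ h h' => h.trans h')
      (fun z k _ _ => (hrep z).conn_of_shift hd hN hunit (by omega) (by omega) hcount z k (hrep _))
      ⟨inf_le_left, le_sup_left⟩ ⟨inf_le_right, le_sup_right⟩
  have hx : ∀ x ∈ O, LatticeConn N O x (rep (x - fun _ => K + D)) := by
    intro x hx
    have he : x + (fun _ => (K + D : ℤ)) = (x - fun _ => (K + D : ℤ)) + fun _ => M := by
      ext i; simp only [Pi.add_apply, Pi.sub_apply]; omega
    obtain ⟨p, hp, hxp⟩ := exists_onOpenSlice_conn hN hunit hD hK hx (by rw [he]; exact hcount' _)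
    rw [he] at hp
    exact hxp.trans (hp.conn hd hN hunit (hcount' _) (hKM _) (hrep _))
  exact ⟨⟨rep 0, (hrep 0).mem⟩, fun x hx' y hy =>
    ((hx x hx').trans (hall _ _)).trans ((hx y hy).symm hN)⟩

end Lattice

/-! ### Lifting blocks of the torus to the lattice -/

/-- The index of the block of the torus below the lattice point `z`. -/
def torusIndex {d : ℕ} (m : ℕ) [NeZero m] (z : Fin d → ℤ) : Fin d → Fin m := fun i =>
  ⟨(z i % m).toNat, by
    have := Int.emod_lt_of_pos (z i) (Int.natCast_pos.2 (NeZero.pos m))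
    have := Int.emod_nonneg (z i) (Int.natCast_ne_zero.2 (NeZero.ne m))
    omega⟩

section Torus

variable {d m : ℕ} [NeZero m]

theorem coe_torusIndex (z : Fin d → ℤ) (i : Fin d) : ((torusIndex m z i : ℕ) : ℤ) = z i % m :=
  Int.toNat_of_nonneg (Int.emod_nonneg (z i) (Int.natCast_ne_zero.2 (NeZero.ne m)))

theorem torusIndex_coe (k : Fin d → Fin m) : torusIndex m (fun i => ((k i : ℕ) : ℤ)) = k := by
  ext i
  have h := coe_torusIndex (m := m) (fun i => ((k i : ℕ) : ℤ)) i
  have : ((k i : ℕ) : ℤ) % m = (k i : ℕ) :=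
    Int.emod_eq_of_lt (by positivity) (by exact_mod_cast (k i).2)
  omega

theorem torusIndex_add_coe (z o : Fin d → ℤ) :
    torusIndex m ((fun i => ((torusIndex m z i : ℕ) : ℤ)) + o) = torusIndex m (z + o) := by
  ext i
  have h1 := coe_torusIndex (m := m) ((fun i => ((torusIndex m z i : ℕ) : ℤ)) + o) i
  have h2 := coe_torusIndex (m := m) (z + o) i
  rw [Pi.add_apply, coe_torusIndex z i, Int.emod_add_emod] at h1
  rw [Pi.add_apply] at h2
  omega

/-- A box shorter than the torus does not wrap around, so distinct closed lattice points in it come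
from distinct, hence independent, blocks. -/
theorem torusIndex_add_injOn {M : ℤ} (hM : M < m) (z : Fin d → ℤ) :
    Set.InjOn (fun o => torusIndex m (z + o)) (Set.Icc 0 (fun _ => M)) := by
  intro o ho o' ho' h
  ext i
  have h1 := coe_torusIndex (m := m) (z + o) i
  have h2 := coe_torusIndex (m := m) (z + o') i
  have h0 : torusIndex m (z + o) = torusIndex m (z + o') := h
  rw [h0, h2, Pi.add_apply, Pi.add_apply] at h1
  have h3 : (m : ℤ) ∣ o' i - o i := by
    have h4 := Int.ModEq.dvd (h1.symm : z i + o i ≡ z i + o' i [ZMOD m])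
    simpa using h4
  have h5 := Pi.mem_Icc_int.1 ho i
  have h6 := Pi.mem_Icc_int.1 ho' i
  simp only [Pi.zero_apply] at h5 h6
  have := Int.eq_zero_of_abs_lt_dvd h3 (by rw [abs_lt]; omega)
  omega

theorem block_bounds {n : ℝ} {k : Fin d → Fin m} {x : EuclideanSpace ℝ (Fin d)}
    (hx : x ∈ block d n m k) (i : Fin d) :
    -(sideLength d n / 2) + (k i : ℕ) * (sideLength d n / m) ≤ x i ∧
      x i ≤ -(sideLength d n / 2) + ((k i : ℕ) + 1) * (sideLength d n / m) := by
  refine ⟨(hx i).1, ?_⟩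
  rcases (hx i).2 with h | ⟨h, h'⟩
  · exact h.le
  · have hm : (m : ℝ) ≠ 0 := Nat.cast_ne_zero.2 (NeZero.ne m)
    have : ((k i : ℕ) + 1 : ℝ) = m := by exact_mod_cast h
    rw [h', this, mul_div_cancel₀ _ hm]
    linarith

/-- Some representative of each coordinate difference modulo the torus length differs from the
offset of the lifts, in block sides, by at most one side; the toroidal coordinate is no longer than
it. -/
theorem torusDist_le {n : ℝ} (hn : 0 ≤ n) {z w : Fin d → ℤ} {x y : EuclideanSpace ℝ (Fin d)}
    (hx : x ∈ block d n m (torusIndex m z)) (hy : y ∈ block d n m (torusIndex m w)) :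
    torusDist n x y ≤ sideLength d n / m * √(∑ i, (|((w - z) i : ℝ)| + 1) ^ 2) := by
  have hL : 0 ≤ sideLength d n := Real.rpow_nonneg hn _
  have hm : (0 : ℝ) < m := Nat.cast_pos.2 (NeZero.pos m)
  set s := sideLength d n / m with hs
  have hs0 : 0 ≤ s := by positivity
  have hsL : sideLength d n = m * s := by rw [hs]; field_simp
  rw [torusDist, ← Real.sqrt_sq hs0, ← Real.sqrt_mul (sq_nonneg s)]
  refine Real.sqrt_le_sqrt ?_
  rw [Finset.mul_sum]
  refine Finset.sum_le_sum fun i _ => ?_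
  rw [← mul_pow]
  obtain ⟨hx1, hx2⟩ := block_bounds hx i
  obtain ⟨hy1, hy2⟩ := block_bounds hy i
  rw [← hs] at hx1 hx2 hy1 hy2
  have hza : ((torusIndex m z i : ℕ) : ℝ) = z i - m * ((z i / m : ℤ) : ℝ) := by
    have := coe_torusIndex (m := m) z i
    rw [Int.emod_def] at this
    exact_mod_cast this
  have hwa : ((torusIndex m w i : ℕ) : ℝ) = w i - m * ((w i / m : ℤ) : ℝ) := by
    have := coe_torusIndex (m := m) w i
    rw [Int.emod_def] at this
    exact_mod_cast this
  have hz2 : ((torusIndex m z i : ℕ) : ℝ) + 1 ≤ m := by exact_mod_cast (torusIndex m z i).2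
  have hw2 : ((torusIndex m w i : ℕ) : ℝ) + 1 ≤ m := by exact_mod_cast (torusIndex m w i).2
  have hz1 : (0 : ℝ) ≤ (torusIndex m z i : ℕ) := by positivity
  have hw1 : (0 : ℝ) ≤ (torusIndex m w i : ℕ) := by positivity
  have hxy : |x i - y i| ≤ sideLength d n := by
    rw [hsL, abs_le]
    have e1 := mul_le_mul_of_nonneg_right hz2 hs0
    have e2 := mul_le_mul_of_nonneg_right hw2 hs0
    have e3 := mul_nonneg hz1 hs0
    have e4 := mul_nonneg hw1 hs0
    constructor <;> linarith
  -- The relative winding number of the lifts. For `q = 0` the direct difference is bounded,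
  -- otherwise the wrapped one, using `|q| ≥ 1`.
  set q : ℤ := w i / m - z i / m with hq
  have hmain : |x i - y i + ((w - z) i : ℝ) * s - q * sideLength d n| ≤ s := by
    rw [hza] at hx1 hx2
    rw [hwa] at hy1 hy2
    have hqc : (q : ℝ) = ((w i / m : ℤ) : ℝ) - ((z i / m : ℤ) : ℝ) := by rw [hq]; push_cast; rfl
    rw [hqc, hsL]
    simp only [Pi.sub_apply, Int.cast_sub]
    rw [abs_le]
    constructor <;> linarith
  refine pow_le_pow_left₀ (le_min (abs_nonneg _) (by linarith)) ?_ 2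
  have hv : |x i - y i - q * sideLength d n| ≤ s * (|((w - z) i : ℝ)| + 1) := by
    have := abs_sub (x i - y i + ((w - z) i : ℝ) * s - q * sideLength d n) (((w - z) i : ℝ) * s)
    rw [abs_mul, abs_of_nonneg hs0] at this
    rw [show x i - y i - q * sideLength d n =
      x i - y i + ((w - z) i : ℝ) * s - q * sideLength d n - ((w - z) i : ℝ) * s by ring]
    linarith
  by_cases hq0 : q = 0
  · rw [hq0] at hv
    exact (min_le_left _ _).trans (by simpa using hv)
  · refine (min_le_right _ _).trans (le_trans ?_ hv)
    have h1 : (1 : ℝ) ≤ |(q : ℝ)| := by exact_mod_cast Int.one_le_abs hq0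
    have h2 := abs_sub_abs_le_abs_sub ((q : ℝ) * sideLength d n) (x i - y i)
    rw [abs_sub_comm (_ * _), abs_mul, abs_of_nonneg hL] at h2
    have h3 := mul_le_mul_of_nonneg_right h1 hL
    linarith

/-- If the lattice lift of the occupied blocks is nonempty and connected, where steps of `N` lead
to mutually visible blocks, then the visibility graph is connected. -/
theorem visibilityGraph_connected {n δ : ℝ} (hn : 0 ≤ n) {V : Set (EuclideanSpace ℝ (Fin d))}
    {N : Finset (Fin d → ℤ)}
    (hvis : ∀ v ∈ N, sideLength d n / m * √(∑ i, (|(v i : ℝ)| + 1) ^ 2) ≤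
      (Real.log n) ^ (1 / (d : ℝ)))
    {O : Set (Fin d → ℤ)} (hO : O = {z | OccupiedBlock d n m δ V (torusIndex m z)})
    (hne : O.Nonempty) (hconn : ∀ x ∈ O, ∀ y ∈ O, LatticeConn N O x y) :
    (visibilityGraph d n m δ V).Connected := by
  have hreach : ∀ z w, LatticeConn N O z w → ∀ (hz : OccupiedBlock d n m δ V (torusIndex m z))
      (hw : OccupiedBlock d n m δ V (torusIndex m w)),
      (visibilityGraph d n m δ V).Reachable ⟨torusIndex m z, hz⟩ ⟨torusIndex m w, hw⟩ := by
    intro z w h hz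
    induction h with
    | refl => intro _; rfl
    | @tail u w huu huw ih =>
      intro hw
      have hu : OccupiedBlock d n m δ V (torusIndex m u) := by
        have := huw.1; rwa [hO] at this
      refine (ih hu).trans ?_
      -- Different lattice points may represent the same block, and the graph has no loops.
      by_cases he : torusIndex m u = torusIndex m w
      · have : (⟨torusIndex m u, hu⟩ : {k : Fin d → Fin m // OccupiedBlock d n m δ V k}) =
          ⟨torusIndex m w, hw⟩ := Subtype.ext he
        rw [this]
      · refine SimpleGraph.Adj.reachable ⟨fun h => he (congrArg Subtype.val h), ?_⟩
        intro x hx y hy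
        refine (torusDist_le hn hx hy).trans ?_
        simpa using hvis _ huw.2.2
  have : Nonempty {k : Fin d → Fin m // OccupiedBlock d n m δ V k} := by
    obtain ⟨z, hz⟩ := hne
    rw [hO] at hz
    exact ⟨⟨_, hz⟩⟩
  refine SimpleGraph.Connected.mk fun k l => ?_
  have hmem : ∀ k : {k : Fin d → Fin m // OccupiedBlock d n m δ V k},
      (fun i => ((k.1 i : ℕ) : ℤ)) ∈ O := fun k => by
    rw [hO, Set.mem_ofPred_eq, torusIndex_coe]; exact k.2
  have h := hreach _ _ (hconn _ (hmem k) _ (hmem l))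
    (by rw [torusIndex_coe]; exact k.2) (by rw [torusIndex_coe]; exact l.2)
  simpa only [torusIndex_coe] using h

end Torus

/-! ### Counting visible offsets -/

theorem volume_preimage_ofLp {d : ℕ} {s : Set (Fin d → ℝ)} (hs : MeasurableSet s) :
    volume ((fun x : EuclideanSpace ℝ (Fin d) => (x.ofLp : Fin d → ℝ)) ⁻¹' s) = volume s :=
  (PiLp.volume_preserving_ofLp (Fin d)).measure_preimage hs.nullMeasurableSet

open Classical in
/-- The lattice vectors `v` with `∑ (|v i| + 1)² < ρ²`: the offsets of unit cubes whose
points are at distance less than `ρ` from all points of the cube at the origin. -/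
noncomputable def visSteps (d : ℕ) (ρ : ℝ) : Finset (Fin d → ℤ) :=
  {v ∈ Fintype.piFinset fun _ => Finset.Icc (-⌈ρ⌉) ⌈ρ⌉ | ∑ i, (|(v i : ℝ)| + 1) ^ 2 < ρ ^ 2}

section VisSteps

variable {d : ℕ} {ρ : ℝ}

/-- The bounding box in the definition only provides finiteness; the inequality implies it. -/
theorem mem_visSteps (hρ : 0 ≤ ρ) {v : Fin d → ℤ} :
    v ∈ visSteps d ρ ↔ ∑ i, (|(v i : ℝ)| + 1) ^ 2 < ρ ^ 2 := by
  rw [visSteps, Finset.mem_filter, and_iff_right_iff_imp, Fintype.mem_piFinset]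
  intro h i
  have h1 := Finset.single_le_sum (f := fun i => (|(v i : ℝ)| + 1) ^ 2)
    (fun i _ => sq_nonneg _) (Finset.mem_univ i)
  have h2 := lt_of_pow_lt_pow_left₀ 2 hρ (h1.trans_lt h)
  have h3 : (|v i| : ℝ) ≤ ⌈ρ⌉ := by linarith [Int.le_ceil ρ]
  have h4 : |v i| ≤ ⌈ρ⌉ := by exact_mod_cast h3
  rw [Finset.mem_Icc]
  exact abs_le.1 h4

theorem abs_le_of_mem_visSteps {v : Fin d → ℤ} (hv : v ∈ visSteps d ρ) (i : Fin d) :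
    |v i| ≤ ⌈ρ⌉ := by
  rw [visSteps, Finset.mem_filter, Fintype.mem_piFinset] at hv
  exact abs_le.2 (Finset.mem_Icc.1 (hv.1 i))

theorem isSolidSet_visSteps (hρ : 0 ≤ ρ) : IsSolidSet (visSteps d ρ) := by
  intro v hv w hw
  rw [mem_visSteps hρ] at hv ⊢
  refine (Finset.sum_le_sum fun i _ => ?_).trans_lt hv
  have : |(w i : ℝ)| ≤ |(v i : ℝ)| := by exact_mod_cast hw i
  gcongr

theorem single_mem_visSteps (hρ : 0 ≤ ρ) (h : (d : ℝ) + 3 < ρ ^ 2) (i : Fin d) :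
    Pi.single i 1 ∈ visSteps d ρ := by
  rw [mem_visSteps hρ]
  refine lt_of_eq_of_lt ?_ h
  rw [← Finset.add_sum_erase _ _ (Finset.mem_univ i)]
  have : ∀ j ∈ Finset.univ.erase i,
      (|(((Pi.single i 1 : Fin d → ℤ) j : ℤ) : ℝ)| + 1) ^ 2 = 1 := by
    intro j hj
    simp [Pi.single_eq_of_ne (Finset.ne_of_mem_erase hj)]
  rw [Finset.sum_congr rfl this]
  have hd : 1 ≤ d := by have := i.2; omega
  simp [Finset.card_erase_of_mem, Nat.cast_sub hd]
  ring

/-- Unit cubes centred at the vectors of `visSteps` cover the smaller ball: rounding costs `1/2` per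
coordinate and the offset condition adds `1`, in total a vector of norm `3√d/2`. -/
theorem unitBallVolume_mul_pow_le_card (hd : 0 < d) (hρ : 3 * √(d : ℝ) / 2 ≤ ρ) :
    unitBallVolume d * (ρ - 3 * √(d : ℝ) / 2) ^ d ≤ (visSteps d ρ).card := by
  have : Nonempty (Fin d) := ⟨⟨0, hd⟩⟩
  have : Nontrivial (EuclideanSpace ℝ (Fin d)) := inferInstance
  set t := ρ - 3 * √(d : ℝ) / 2 with ht
  have ht0 : 0 ≤ t := by linarith
  have hρ0 : 0 ≤ ρ := le_trans (by positivity) hρ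
  let cube : (Fin d → ℤ) → Set (EuclideanSpace ℝ (Fin d)) := fun j =>
    (fun x : EuclideanSpace ℝ (Fin d) => (x.ofLp : Fin d → ℝ)) ⁻¹'
      Set.Icc (fun i => (j i : ℝ) - 1 / 2) (fun i => (j i : ℝ) + 1 / 2)
  have hvol : ∀ j, volume (cube j) = 1 := by
    intro j
    rw [volume_preimage_ofLp measurableSet_Icc, Real.volume_Icc_pi]
    refine Finset.prod_eq_one fun i _ => ?_
    rw [show (j i : ℝ) + 1 / 2 - (j i - 1 / 2) = 1 by ring, ENNReal.ofReal_one]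
  have hsub : Metric.ball (0 : EuclideanSpace ℝ (Fin d)) t ⊆ ⋃ j ∈ visSteps d ρ, cube j := by
    intro x hx
    rw [mem_ball_zero_iff] at hx
    simp only [Set.mem_iUnion]
    have hr : ∀ i, |x i - round (x i)| ≤ 1 / 2 := fun i => abs_sub_round (x i)
    refine ⟨fun i => round (x i), ?_, ?_⟩
    · rw [mem_visSteps hρ0]
      let y : EuclideanSpace ℝ (Fin d) := WithLp.toLp 2 fun i => |x i|
      let z : EuclideanSpace ℝ (Fin d) := WithLp.toLp 2 fun _ => 3 / 2
      have hy : ‖y‖ = ‖x‖ := by simp [EuclideanSpace.norm_eq, y]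
      have hz : ‖z‖ = 3 * √(d : ℝ) / 2 := by
        simp only [EuclideanSpace.norm_eq, z, Finset.sum_const, Finset.card_univ, Fintype.card_fin,
          nsmul_eq_mul]
        rw [Real.sqrt_mul (by positivity), Real.sqrt_sq (norm_nonneg _),
          Real.norm_of_nonneg (by norm_num)]
        ring
      have hyz : ‖y + z‖ < ρ := by
        have := norm_add_le y z
        linarith
      have hsq : ‖y + z‖ ^ 2 < ρ ^ 2 := pow_lt_pow_left₀ hyz (norm_nonneg _) two_ne_zero
      rw [EuclideanSpace.norm_sq_eq] at hsq
      refine (Finset.sum_le_sum fun i _ => ?_).trans_lt hsq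
      have h1 : (y + z) i = |x i| + 3 / 2 := rfl
      rw [h1, Real.norm_of_nonneg (by positivity)]
      have h2 := abs_sub_abs_le_abs_sub ((round (x i) : ℤ) : ℝ) (x i)
      rw [abs_sub_comm] at h2
      have h3 := hr i
      gcongr ?_ ^ 2
      linarith
    · refine ⟨fun i => ?_, fun i => ?_⟩
      · have := abs_le.1 (hr i); simp only; linarith
      · have := abs_le.1 (hr i); simp only; linarith
  have h1 := (measure_mono hsub).trans (measure_biUnion_finset_le (μ := volume) _ cube)
  simp only [hvol, Finset.sum_const, nsmul_eq_mul, mul_one] at h1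
  rw [Measure.addHaar_ball volume _ ht0, finrank_euclideanSpace_fin] at h1
  have h2 := ENNReal.toReal_mono (ENNReal.natCast_ne_top _) h1
  rw [ENNReal.toReal_mul, ENNReal.toReal_ofReal (by positivity), ENNReal.toReal_natCast] at h2
  rw [unitBallVolume]
  linarith

/-- The inscribed cube has side `2/√d`. -/
theorem pow_le_unitBallVolume (hd : 0 < d) : (2 / √(d : ℝ)) ^ d ≤ unitBallVolume d := by
  have hd' : (0 : ℝ) < d := Nat.cast_pos.2 hd
  have : Nonempty (Fin d) := ⟨⟨0, hd⟩⟩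
  let S : Set (Fin d → ℝ) := Set.univ.pi fun _ => Set.Ioo (-(1 / √(d : ℝ))) (1 / √(d : ℝ))
  have hS : MeasurableSet S := MeasurableSet.univ_pi fun _ => measurableSet_Ioo
  have hsub : (fun x : EuclideanSpace ℝ (Fin d) => (x.ofLp : Fin d → ℝ)) ⁻¹' S ⊆
      Metric.ball (0 : EuclideanSpace ℝ (Fin d)) 1 := by
    intro x hx
    rw [EuclideanSpace.ball_zero_eq _ zero_le_one]
    have h1 : ∀ i ∈ Finset.univ, x i ^ 2 < 1 / (d : ℝ) := by
      intro i _
      have h := hx i (Set.mem_univ i)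
      have h2 : |x i| < 1 / √(d : ℝ) := abs_lt.2 h
      have h3 := pow_lt_pow_left₀ h2 (abs_nonneg _) two_ne_zero
      rwa [sq_abs, div_pow, Real.sq_sqrt hd'.le, one_pow] at h3
    have h2 := Finset.sum_lt_sum_of_nonempty Finset.univ_nonempty h1
    simp only [Finset.sum_const, Finset.card_univ, Fintype.card_fin, nsmul_eq_mul] at h2
    rw [mul_one_div_cancel hd'.ne'] at h2
    simpa using h2
  have h1 := measure_mono (μ := volume) hsub
  rw [volume_preimage_ofLp hS, Real.volume_pi_Ioo] at h1
  have h2 := ENNReal.toReal_mono measure_ball_lt_top.ne h1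
  rw [Finset.prod_const, Finset.card_univ, Fintype.card_fin, ENNReal.toReal_pow,
    ENNReal.toReal_ofReal (by simp only [sub_neg_eq_add]; positivity)] at h2
  rw [unitBallVolume]
  refine le_trans (le_of_eq ?_) h2
  congr 1
  ring

end VisSteps

/-! ### Numerical consequences of admissibility -/

section Admissible

variable {d : ℕ} {lam χ : ℝ}

theorem lam_pos_of_one_lt (hlam : 1 < lam * unitBallVolume d) : 0 < lam := by
  by_contra! h
  have : lam * unitBallVolume d ≤ 0 := mul_nonpos_of_nonpos_of_nonneg h ENNReal.toReal_nonneg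
  linarith

theorem ChiAdmissible.pow_ge (h : ChiAdmissible d lam χ) (hlam : 1 < lam * unitBallVolume d) :
    (1 + 1 / (lam * unitBallVolume d)) / 2 ≤
      (1 - 3 * √(d : ℝ) * χ ^ (1 / (d : ℝ)) / 2) ^ d := by
  have hl := lam_pos_of_one_lt hlam
  have hν : 0 < unitBallVolume d := by
    by_contra! h0
    have := mul_nonpos_of_nonneg_of_nonpos hl.le h0
    linarith
  have := h.volume_bound
  have e : (unitBallVolume d + 1 / lam) / 2 =
      unitBallVolume d * ((1 + 1 / (lam * unitBallVolume d)) / 2) := by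
    field_simp
  rw [e] at this
  exact le_of_mul_le_mul_left this hν

/-- With `x` the left side, `(1 - x)^2 ≥ (1 - x)^d > 1/2`, while `0.7^2 < 1/2`. -/
theorem ChiAdmissible.lt_three_tenths (h : ChiAdmissible d lam χ) (hd : 2 ≤ d)
    (hlam : 1 < lam * unitBallVolume d) : 3 * √(d : ℝ) * χ ^ (1 / (d : ℝ)) / 2 < 3 / 10 := by
  have h1 := h.pow_ge hlam
  have hb := h.base_pos
  have hα : 0 < χ ^ (1 / (d : ℝ)) := Real.rpow_pos_of_pos h.pos _
  set x := 3 * √(d : ℝ) * χ ^ (1 / (d : ℝ)) / 2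
  have hx0 : 0 ≤ x := by positivity
  have h2 : (1 - x) ^ d ≤ (1 - x) ^ 2 := pow_le_pow_of_le_one hb.le (by linarith) hd
  have h3 : 0 < 1 / (lam * unitBallVolume d) := by positivity
  by_contra! hx
  nlinarith

theorem ChiAdmissible.visRadius_gt (h : ChiAdmissible d lam χ) : 2 / 3 < visRadius d χ := by
  have hb := h.base_pos
  rw [visRadius]
  linarith

/-- The block of an admissible parameter `χ` has a small volume compared to the slack in the
volume bound. -/
theorem ChiAdmissible.le_third (h : ChiAdmissible d lam χ) (hd : 2 ≤ d)
    (hlam : 1 < lam * unitBallVolume d) :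
    χ ≤ unitBallVolume d * ((1 - 1 / (lam * unitBallVolume d)) / 2) / 3 := by
  have h1 := h.pow_ge hlam
  have hb := h.base_pos
  have hd0 : (0 : ℝ) < d := by positivity
  have hα : 0 < χ ^ (1 / (d : ℝ)) := Real.rpow_pos_of_pos h.pos _
  have hpow : (χ ^ (1 / (d : ℝ))) ^ d = χ := by
    rw [one_div, Real.rpow_inv_natCast_pow h.pos.le (by omega)]
  set α := χ ^ (1 / (d : ℝ))
  set x := 3 * √(d : ℝ) * α / 2 with hx
  have hx0 : 0 ≤ x := by positivity
  have h2 : (1 - x) ^ d ≤ 1 - x := by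
    simpa using pow_le_pow_of_le_one hb.le (by linarith) (show 1 ≤ d by omega)
  have hν := pow_le_unitBallVolume (d := d) (by omega)
  -- The second factor is the volume of the cube inscribed in the unit ball, hence at most `ν_d`.
  have hχ : χ = (x / 3) ^ d * (2 / √(d : ℝ)) ^ d := by
    rw [← mul_pow, ← hpow, hx]
    congr 1
    field_simp
  have h3 : (x / 3) ^ d ≤ x / 3 := by
    simpa using pow_le_pow_of_le_one (show 0 ≤ x / 3 by positivity) (by linarith)
      (show 1 ≤ d by omega)
  have h4 : x / 3 ≤ (1 - 1 / (lam * unitBallVolume d)) / 2 / 3 := by linarith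
  have hν0 : 0 ≤ unitBallVolume d := ENNReal.toReal_nonneg
  calc χ = (x / 3) ^ d * (2 / √(d : ℝ)) ^ d := hχ
    _ ≤ (1 - 1 / (lam * unitBallVolume d)) / 2 / 3 * unitBallVolume d :=
        mul_le_mul (h3.trans h4) hν (by positivity) (le_trans (by positivity) h4)
    _ = _ := by ring

/-- This is the condition under which unit vectors are visible offsets. -/
theorem ChiAdmissible.lt_sq (h : ChiAdmissible d lam χ) (hd : 2 ≤ d)
    (hlam : 1 < lam * unitBallVolume d) : (d : ℝ) + 3 < (1 / χ ^ (1 / (d : ℝ))) ^ 2 := by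
  have hx := h.lt_three_tenths hd hlam
  have hα : 0 < χ ^ (1 / (d : ℝ)) := Real.rpow_pos_of_pos h.pos _
  set α := χ ^ (1 / (d : ℝ))
  have hd2 : (2 : ℝ) ≤ d := by exact_mod_cast hd
  have h1 : √(d : ℝ) * α < 1 / 5 := by linarith
  have h2 := pow_lt_pow_left₀ h1 (by positivity) two_ne_zero
  rw [mul_pow, Real.sq_sqrt (by positivity)] at h2
  rw [div_pow, one_pow, lt_div_iff₀ (by positivity)]
  have : 0 < α ^ 2 := by positivity
  nlinarith

/-- The volume bound gives `λχ|N| ≥ (λν_d + 1)/2`. The one vector lost in Cauchy–Davenport costs `λχ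
≤ (λν_d - 1)/6`, leaving a third of the slack. -/
theorem ChiAdmissible.card_bound (h : ChiAdmissible d lam χ) (hd : 2 ≤ d)
    (hlam : 1 < lam * unitBallVolume d) :
    1 + (lam * unitBallVolume d - 1) / 3 ≤
      lam * χ * ((visSteps d (1 / χ ^ (1 / (d : ℝ)))).card - 1) := by
  have hl := lam_pos_of_one_lt hlam
  have hα : 0 < χ ^ (1 / (d : ℝ)) := Real.rpow_pos_of_pos h.pos _
  have hpow : (χ ^ (1 / (d : ℝ))) ^ d = χ := by
    rw [one_div, Real.rpow_inv_natCast_pow h.pos.le (by omega)]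
  have hb := h.base_pos
  have h1 := h.pow_ge hlam
  have h3 := h.le_third hd hlam
  set α := χ ^ (1 / (d : ℝ))
  have hρ : 3 * √(d : ℝ) / 2 ≤ 1 / α := by
    rw [le_div_iff₀ hα]; linarith
  have hcard := unitBallVolume_mul_pow_le_card (d := d) (by omega) hρ
  have he : χ * (1 / α - 3 * √(d : ℝ) / 2) ^ d = (1 - 3 * √(d : ℝ) * α / 2) ^ d := by
    rw [← hpow, ← mul_pow]
    congr 1
    field_simp
  set ν := unitBallVolume d
  set c : ℝ := ((visSteps d (1 / α)).card : ℝ)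
  have hν0 : 0 ≤ ν := ENNReal.toReal_nonneg
  have hΛ : lam * ν * (1 / (lam * ν)) = 1 := by
    rw [mul_one_div_cancel (by linarith)]
  have h4 : ν * ((1 + 1 / (lam * ν)) / 2) ≤ χ * c := by
    calc ν * ((1 + 1 / (lam * ν)) / 2) ≤ ν * (1 - 3 * √(d : ℝ) * α / 2) ^ d :=
          mul_le_mul_of_nonneg_left h1 hν0
      _ = χ * (ν * (1 / α - 3 * √(d : ℝ) / 2) ^ d) := by rw [← he]; ring
      _ ≤ χ * c := mul_le_mul_of_nonneg_left hcard h.pos.le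
  have h5 := mul_le_mul_of_nonneg_left h4 hl.le
  have h6 := mul_le_mul_of_nonneg_left h3 hl.le
  have e5 : lam * (ν * ((1 + 1 / (lam * ν)) / 2)) = (lam * ν + 1) / 2 := by
    linear_combination (1 / 2) * hΛ
  have e6 : lam * (ν * ((1 - 1 / (lam * ν)) / 2) / 3) = (lam * ν - 1) / 6 := by
    linear_combination (-1 / 6) * hΛ
  rw [e5] at h5
  rw [e6] at h6
  linarith

/-- The exponential tilt `t` and the density `η` of few points, for which the Chernoff bound of a
Poisson variable leaves enough of the slack. -/
theorem exists_chernoff_constants {g : ℝ} (hlam : 0 < lam) (hg : 0 < g) :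
    ∃ t η : ℝ, 0 < t ∧ 0 < η ∧ lam < (lam * (1 - Real.exp (-t)) - t * η) * (1 + g) := by
  -- First `t` is taken large, approaching the exponent of an empty block; then `η` small for this
  -- `t`.
  have h1 : Tendsto (fun t : ℝ => lam * (1 - Real.exp (-t)) * (1 + g)) atTop
      (𝓝 (lam * (1 - 0) * (1 + g))) :=
    ((tendsto_const_nhds.sub Real.tendsto_exp_neg_atTop_nhds_zero).const_mul lam).mul_const _
  obtain ⟨t, ht, ht0⟩ := ((h1.eventually (lt_mem_nhds (a := lam) (by nlinarith))).and
    (eventually_gt_atTop 0)).exists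
  have h2 : Tendsto (fun η : ℝ => (lam * (1 - Real.exp (-t)) - t * η) * (1 + g)) (𝓝[>] 0)
      (𝓝 ((lam * (1 - Real.exp (-t)) - t * 0) * (1 + g))) := by
    refine Tendsto.mono_left (Continuous.tendsto (by fun_prop) 0) nhdsWithin_le_nhds
  obtain ⟨η, hη, hη0⟩ := ((h2.eventually (lt_mem_nhds (a := lam) (by simpa using ht))).and
    self_mem_nhdsWithin).exists
  exact ⟨t, η, ht0, hη0, hη⟩

end Admissible

/-! ### Poisson lower tail -/

/-- The Chernoff bound for the lower tail of the Poisson distribution. -/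
theorem poissonMeasure_le_exp (r : NNReal) {t : ℝ} (ht : 0 ≤ t) (a : ℝ) :
    poissonMeasure r {j | (j : ℝ) ≤ a} ≤
      ENNReal.ofReal (Real.exp (t * a - r * (1 - Real.exp (-t)))) := by
  let f : ℕ → ℝ≥0∞ := fun j => ENNReal.ofReal (Real.exp (t * (a - j)))
  have hsub : {j : ℕ | (j : ℝ) ≤ a} ⊆ {j | 1 ≤ f j} := by
    intro j hj
    have hj' : (j : ℝ) ≤ a := hj
    exact ENNReal.one_le_ofReal.2 (Real.one_le_exp (mul_nonneg ht (by linarith)))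
  have hmarkov := mul_meas_ge_le_lintegral (μ := poissonMeasure r) (f := f) (by fun_prop) 1
  rw [one_mul] at hmarkov
  refine (measure_mono hsub).trans (hmarkov.trans ?_)
  have hsum : HasSum (fun j : ℕ => Real.exp (-r) * r ^ j / j.factorial * Real.exp (t * (a - j)))
      (Real.exp (t * a - r * (1 - Real.exp (-t)))) := by
    have h := (NormedSpace.expSeries_div_hasSum_exp ((r : ℝ) * Real.exp (-t))).mul_left
      (Real.exp (t * a - r))
    rw [← Real.exp_eq_exp_ℝ, ← Real.exp_add] at h
    convert! h using 1
    · ext j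
      rw [mul_pow, ← Real.exp_nat_mul, show t * (a - j) = t * a + j * (-t) by ring, Real.exp_add,
        show t * a - (r : ℝ) = -r + t * a by ring, Real.exp_add]
      ring
    · congr 1; ring
  rw [poissonMeasure, lintegral_sum_measure]
  simp only [lintegral_smul_measure, lintegral_dirac, smul_eq_mul, f]
  have he : ∀ j : ℕ, ENNReal.ofReal (Real.exp (-r) * r ^ j / j.factorial) *
      ENNReal.ofReal (Real.exp (t * (a - j))) =
      ENNReal.ofReal (Real.exp (-r) * r ^ j / j.factorial * Real.exp (t * (a - j))) := fun j =>
    (ENNReal.ofReal_mul (by positivity)).symm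
  simp only [he]
  rw [← ENNReal.ofReal_tsum_of_nonneg (fun j => by positivity) hsum.summable, hsum.tsum_eq]

/-! ### Measurability, disjointness and volume of blocks -/

section Blocks

variable {d m : ℕ} {n : ℝ}

theorem measurableSet_block (k : Fin d → Fin m) : MeasurableSet (block d n m k) := by
  have : block d n m k = ⋂ i, {x : EuclideanSpace ℝ (Fin d) |
      -(sideLength d n / 2) + (k i : ℕ) * (sideLength d n / m) ≤ x i ∧
        (x i < -(sideLength d n / 2) + ((k i : ℕ) + 1) * (sideLength d n / m) ∨
          ((k i : ℕ) + 1 = m ∧ x i = sideLength d n / 2))} := by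
    ext x; simp [block]
  rw [this]
  refine MeasurableSet.iInter fun i => ?_
  have hx : Measurable fun x : EuclideanSpace ℝ (Fin d) => x i := by fun_prop
  exact (measurableSet_le measurable_const hx).inter ((measurableSet_lt hx measurable_const).union
    ((MeasurableSet.const _).inter (measurableSet_eq_fun hx measurable_const)))

theorem disjoint_block (hn : 0 ≤ n) {k l : Fin d → Fin m} (h : k ≠ l) :
    Disjoint (block d n m k) (block d n m l) := by
  have hL : 0 ≤ sideLength d n / m := div_nonneg (Real.rpow_nonneg hn _) (by positivity)
  have key : ∀ (k l : Fin d → Fin m) (i : Fin d), (k i : ℕ) < l i → ∀ x, x ∈ block d n m k →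
      x ∈ block d n m l → False := by
    intro k l i hi x hk hl
    have h1 := (hl i).1
    have h2 : ((k i : ℕ) : ℝ) + 1 ≤ (l i : ℕ) := by exact_mod_cast hi
    rcases (hk i).2 with h3 | ⟨h3, -⟩
    · have := mul_le_mul_of_nonneg_right h2 hL
      linarith
    · have := (l i).2
      omega
  obtain ⟨i, hi⟩ := Function.ne_iff.1 h
  rw [Set.disjoint_left]
  intro x hk hl
  rcases lt_or_gt_of_ne (fun h => hi (Fin.ext h) : (k i : ℕ) ≠ l i) with h | h
  · exact key k l i h x hk hl
  · exact key l k i h x hl hk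

theorem sideLength_pow (hd : d ≠ 0) (hn : 0 ≤ n) : sideLength d n ^ d = n := by
  rw [sideLength, one_div, Real.rpow_inv_natCast_pow hn hd]

theorem isBounded_block [NeZero m] (k : Fin d → Fin m) :
    Bornology.IsBounded (block d n m k) := by
  have h : Bornology.IsBounded ((fun x : EuclideanSpace ℝ (Fin d) => (x.ofLp : Fin d → ℝ)) ⁻¹'
      Set.Icc (fun i => -(sideLength d n / 2) + (k i : ℕ) * (sideLength d n / m))
        (fun i => -(sideLength d n / 2) + ((k i : ℕ) + 1) * (sideLength d n / m))) :=
    (PiLp.antilipschitzWith_ofLp 2 fun _ : Fin d => ℝ).isBounded_preimage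
      (Metric.isBounded_Icc _ _)
  exact h.subset fun x hx =>
    ⟨fun i => (block_bounds hx i).1, fun i => (block_bounds hx i).2⟩

/-- A lower bound suffices, since more volume only makes vacancy less likely; the half-open cube
inside the block gives it. -/
theorem volume_block_inter_region_ge [NeZero m] (hd : d ≠ 0) (hn : 0 ≤ n) (k : Fin d → Fin m) :
    n / (m : ℝ) ^ d ≤ (volume (block d n m k ∩ region d n)).toReal := by
  have hm : (0 : ℝ) < m := Nat.cast_pos.2 (NeZero.pos m)
  have hL : 0 ≤ sideLength d n := Real.rpow_nonneg hn _
  set s := sideLength d n / m with hs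
  have hs0 : 0 ≤ s := by positivity
  have hsL : sideLength d n = m * s := by rw [hs]; field_simp
  let S : Set (Fin d → ℝ) := Set.univ.pi fun i =>
    Set.Ico (-(sideLength d n / 2) + (k i : ℕ) * s) (-(sideLength d n / 2) + ((k i : ℕ) + 1) * s)
  have hS : MeasurableSet S := MeasurableSet.univ_pi fun _ => measurableSet_Ico
  have hsub : (fun x : EuclideanSpace ℝ (Fin d) => (x.ofLp : Fin d → ℝ)) ⁻¹' S ⊆
      block d n m k ∩ region d n := by
    intro x hx
    refine ⟨fun i => ⟨(hx i trivial).1, Or.inl (hx i trivial).2⟩, fun i => ?_⟩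
    obtain ⟨h1, h2⟩ := hx i trivial
    have h3 : ((k i : ℕ) : ℝ) + 1 ≤ m := by exact_mod_cast (k i).2
    have h4 := mul_le_mul_of_nonneg_right h3 hs0
    have h5 : 0 ≤ ((k i : ℕ) : ℝ) * s := by positivity
    constructor <;> linarith
  have h1 := measure_mono (μ := volume) hsub
  rw [volume_preimage_ofLp hS, Real.volume_pi_Ico] at h1
  have hfin : volume (block d n m k ∩ region d n) ≠ ⊤ :=
    ((isBounded_block k).subset Set.inter_subset_left).measure_lt_top.ne
  refine le_trans (le_of_eq ?_) (ENNReal.toReal_mono hfin h1)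
  have he : ∀ i, -(sideLength d n / 2) + ((k i : ℕ) + 1) * s -
      (-(sideLength d n / 2) + (k i : ℕ) * s) = s := fun i => by ring
  simp only [he]
  rw [Finset.prod_const, Finset.card_univ, Fintype.card_fin, ENNReal.toReal_pow,
    ENNReal.toReal_ofReal hs0, hs, div_pow, sideLength_pow hd hn]

end Blocks

/-! ### Probability of many unoccupied blocks in a box -/

section PoissonBlocks

variable {d m : ℕ} {n lam δ : ℝ} {Ω : Type*} [MeasurableSpace Ω] {P : Measure Ω}
  {V : Ω → Set (EuclideanSpace ℝ (Fin d))}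

theorem IsPoissonPointProcess.measure_not_occupied_le [NeZero m]
    (hV : IsPoissonPointProcess P (region d n) lam V) (hd : d ≠ 0) (hn : 0 ≤ n) (hlam : 0 ≤ lam)
    {t : ℝ} (ht : 0 ≤ t) (k : Fin d → Fin m) :
    P {ω | ¬ OccupiedBlock d n m δ (V ω) k} ≤ ENNReal.ofReal (Real.exp (t * (δ * Real.log n) -
      lam * (n / (m : ℝ) ^ d) * (1 - Real.exp (-t)))) := by
  let A : Set ℕ∞ := {c | ¬ ENNReal.ofReal (δ * Real.log n) ≤ (c : ℝ≥0∞)}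
  have hset : {ω | ¬ OccupiedBlock d n m δ (V ω) k} =
      (fun ω => (V ω ∩ block d n m k).encard) ⁻¹' A := rfl
  rw [hset, ← Measure.map_apply (hV.measurable_count _ (measurableSet_block k)) .of_discrete,
    hV.law_count _ (measurableSet_block k) (isBounded_block k),
    Measure.map_apply .of_discrete .of_discrete]
  have hsub : (fun j : ℕ => (j : ℕ∞)) ⁻¹' A ⊆ {j | (j : ℝ) ≤ δ * Real.log n} := by
    intro j hj
    have hj' : ¬ ENNReal.ofReal (δ * Real.log n) ≤ ((j : ℕ∞) : ℝ≥0∞) := hj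
    rw [ENat.toENNReal_coe, not_le] at hj'
    rw [← ENNReal.ofReal_natCast, ENNReal.ofReal_lt_ofReal_iff_of_nonneg (by positivity)] at hj'
    exact hj'.le
  refine (measure_mono hsub).trans ((poissonMeasure_le_exp _ ht _).trans ?_)
  refine ENNReal.ofReal_le_ofReal (Real.exp_le_exp.2 ?_)
  have h1 := volume_block_inter_region_ge hd hn k
  rw [Real.coe_toNNReal _ (mul_nonneg hlam ENNReal.toReal_nonneg)]
  have h2 : 0 ≤ 1 - Real.exp (-t) := by
    rw [sub_nonneg, Real.exp_le_one_iff]; linarith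
  gcongr

theorem IsPoissonPointProcess.measure_inter_not_occupied_le
    (hV : IsPoissonPointProcess P (region d n) lam V) (hn : 0 ≤ n) {q : ℝ≥0∞}
    (hq : ∀ k : Fin d → Fin m, P {ω | ¬ OccupiedBlock d n m δ (V ω) k} ≤ q)
    (S : Finset (Fin d → Fin m)) :
    P {ω | ∀ k ∈ S, ¬ OccupiedBlock d n m δ (V ω) k} ≤ q ^ S.card := by
  let e := S.equivFin.symm
  let A : Set ℕ∞ := {c | ¬ ENNReal.ofReal (δ * Real.log n) ≤ (c : ℝ≥0∞)}
  have hind := hV.indep_count S.card (fun j => block d n m (e j).1)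
    (fun j => measurableSet_block _)
    (fun i j hij => disjoint_block hn fun h => hij (e.injective (Subtype.ext h)))
  have h := hind.measure_inter_preimage_eq_mul Finset.univ (sets := fun _ => A) fun _ _ => trivial
  have hset : {ω | ∀ k ∈ S, ¬ OccupiedBlock d n m δ (V ω) k} =
      ⋂ j ∈ (Finset.univ : Finset (Fin S.card)),
        (fun ω => (V ω ∩ block d n m (e j).1).encard) ⁻¹' A := by
    ext ω
    simp only [Finset.mem_univ, Set.iInter_true, Set.mem_iInter]
    constructor
    · intro h j
      exact h _ (e j).2
    · intro h k hk
      have := h (e.symm ⟨k, hk⟩)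
      rw [e.apply_symm_apply] at this
      exact this
  rw [hset, h]
  calc _ ≤ ∏ _j : Fin S.card, q := Finset.prod_le_prod' fun j _ => hq _
    _ = q ^ S.card := by simp

/-- The union bound for boxes of the lattice lift that contain many unoccupied blocks. -/
theorem IsPoissonPointProcess.measure_exists_box_le [NeZero m]
    (hV : IsPoissonPointProcess P (region d n) lam V) (hn : 0 ≤ n) {q : ℝ≥0∞}
    (hq : ∀ k : Fin d → Fin m, P {ω | ¬ OccupiedBlock d n m δ (V ω) k} ≤ q) {M : ℤ} (hM : M < m)
    (K : ℕ) :
    P {ω | ∃ z : Fin d → ℤ, K ≤ (Set.Icc z (z + fun _ => M) \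
      {z | OccupiedBlock d n m δ (V ω) (torusIndex m z)}).ncard} ≤
      (m : ℝ≥0∞) ^ d *
        (((Finset.Icc (0 : Fin d → ℤ) (fun _ => M)).powersetCard K).card * q ^ K) := by
  classical
  set W := (Finset.Icc (0 : Fin d → ℤ) (fun _ => M)).powersetCard K with hW
  let lift : (Fin d → Fin m) → Fin d → ℤ := fun b i => ((b i : ℕ) : ℤ)
  let E : (Fin d → Fin m) → Finset (Fin d → ℤ) → Set Ω := fun b S =>
    {ω | ∀ k ∈ S.image (fun o => torusIndex m (lift b + o)), ¬ OccupiedBlock d n m δ (V ω) k}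
  have hsub : {ω | ∃ z : Fin d → ℤ, K ≤ (Set.Icc z (z + fun _ => M) \
      {z | OccupiedBlock d n m δ (V ω) (torusIndex m z)}).ncard} ⊆
      ⋃ b ∈ (Finset.univ : Finset (Fin d → Fin m)), ⋃ S ∈ W, E b S := by
    rintro ω ⟨z, hz⟩
    have hfin : (Set.Icc z (z + fun _ => M) \
      {z | OccupiedBlock d n m δ (V ω) (torusIndex m z)}).Finite := (Set.finite_Icc _ _).sdiff
    obtain ⟨T, hT, hTc⟩ := Set.exists_subset_card_eq hz
    have hTfin : T.Finite := hfin.subset hT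
    simp only [Set.mem_iUnion]
    -- Reducing the corner modulo `m` leaves `m^d` positions; the closed points are recorded as
    -- offsets from the corner.
    refine ⟨torusIndex m z, Finset.mem_univ _, hTfin.toFinset.image (fun w => w - z), ?_, ?_⟩
    · rw [hW, Finset.mem_powersetCard]
      refine ⟨fun o ho => ?_, ?_⟩
      · obtain ⟨w, hw, rfl⟩ := Finset.mem_image.1 ho
        have := (hT (hTfin.mem_toFinset.1 hw)).1
        rw [Finset.mem_Icc]
        refine ⟨sub_nonneg.2 this.1, sub_le_iff_le_add'.2 this.2⟩
      · rw [Finset.card_image_of_injective _ (sub_left_injective), ← hTc,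
          Set.ncard_eq_toFinset_card T hTfin]
    · intro k hk
      obtain ⟨o, ho, rfl⟩ := Finset.mem_image.1 hk
      obtain ⟨w, hw, rfl⟩ := Finset.mem_image.1 ho
      have h := (hT (hTfin.mem_toFinset.1 hw)).2
      have he : torusIndex m (lift (torusIndex m z) + (w - z)) = torusIndex m w := by
        rw [torusIndex_add_coe, add_sub_cancel]
      rw [he]
      exact h
  have hE : ∀ b, ∀ S ∈ W, P (E b S) ≤ q ^ K := by
    intro b S hS
    rw [hW, Finset.mem_powersetCard] at hS
    refine (hV.measure_inter_not_occupied_le hn hq _).trans_eq ?_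
    rw [Finset.card_image_of_injOn, hS.2]
    exact (torusIndex_add_injOn hM _).mono fun o ho => by
      have := hS.1 ho
      rwa [Finset.mem_Icc] at this
  calc _ ≤ ∑ b : Fin d → Fin m, P (⋃ S ∈ W, E b S) :=
        (measure_mono hsub).trans (measure_biUnion_finset_le _ _)
    _ ≤ ∑ _b : Fin d → Fin m, (W.card * q ^ K : ℝ≥0∞) := by
        refine Finset.sum_le_sum fun b _ => (measure_biUnion_finset_le _ _).trans ?_
        refine (Finset.sum_le_sum (hE b)).trans_eq ?_
        rw [Finset.sum_const, nsmul_eq_mul]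
    _ = _ := by
        rw [Finset.sum_const, nsmul_eq_mul, Finset.card_univ]
        simp

end PoissonBlocks

/-! ### Asymptotics of the block count -/

section Asymptotics

variable {d : ℕ} {χ : ℝ} {m : ℝ → ℕ}

/-- If `m n = 0`, division by zero makes the ratio `0`, which is excluded near the limit `1`. -/
theorem eventually_blockCount_ne_zero (hd : d ≠ 0)
    (hm : Tendsto (fun n : ℝ => (n / (m n : ℝ) ^ d) / (χ * Real.log n)) atTop (𝓝 1)) :
    ∀ᶠ n in atTop, m n ≠ 0 := by
  filter_upwards [hm.eventually (lt_mem_nhds zero_lt_one)] with n hn h0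
  simp [h0, hd] at hn

theorem eventually_blockCount_pow_le (hχ : 0 < χ)
    (hm : Tendsto (fun n : ℝ => (n / (m n : ℝ) ^ d) / (χ * Real.log n)) atTop (𝓝 1)) :
    ∀ᶠ n in atTop, (m n : ℝ) ^ d ≤ n := by
  have hlog : Tendsto (fun n => χ * Real.log n) atTop atTop :=
    Real.tendsto_log_atTop.const_mul_atTop hχ
  filter_upwards [hm.eventually (lt_mem_nhds (show (1 / 2 : ℝ) < 1 by norm_num)),
    hlog.eventually_ge_atTop 2] with n hn hl
  rw [lt_div_iff₀ (by linarith)] at hn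
  have h1 : 1 ≤ n / (m n : ℝ) ^ d := by linarith
  by_contra! hlt
  have h2 : 0 < (m n : ℝ) ^ d := by
    rcases (show (0 : ℝ) ≤ (m n : ℝ) ^ d by positivity).eq_or_lt with h | h
    · rw [← h, div_zero] at h1; linarith
    · exact h
  rw [le_div_iff₀ h2] at h1
  linarith

/-- A bounded `m n` would force `n = O(log n)`. Growth is needed for a box of fixed size to fit in
the torus without wrapping. -/
theorem tendsto_blockCount (hd : d ≠ 0) (hχ : 0 < χ)
    (hm : Tendsto (fun n : ℝ => (n / (m n : ℝ) ^ d) / (χ * Real.log n)) atTop (𝓝 1)) :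
    Tendsto m atTop atTop := by
  rw [tendsto_atTop]
  intro M
  have hlog : Tendsto (fun n => χ * Real.log n) atTop atTop :=
    Real.tendsto_log_atTop.const_mul_atTop hχ
  have hc : 0 < 1 / (2 * χ * (M + 1) ^ d) := by positivity
  filter_upwards [hm.eventually (gt_mem_nhds (show (1 : ℝ) < 2 by norm_num)),
    hlog.eventually_gt_atTop 0, eventually_blockCount_ne_zero hd hm, eventually_gt_atTop 0,
    Real.isLittleO_log_id_atTop.bound hc] with n hn hl h0 hn0 hlo
  by_contra! hlt
  have hm0 : (0 : ℝ) < (m n : ℝ) ^ d := by positivity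
  rw [div_lt_iff₀ hl, div_lt_iff₀ hm0] at hn
  have h1 : (m n : ℝ) ^ d ≤ (M + 1) ^ d := by
    gcongr
    exact_mod_cast (by omega : m n ≤ M + 1)
  have h2 := mul_le_mul_of_nonneg_left h1 (show 0 ≤ 2 * (χ * Real.log n) by linarith)
  have hlog0 : 0 ≤ Real.log n := (pos_of_mul_pos_right hl hχ.le).le
  rw [Real.norm_of_nonneg hlog0, id, Real.norm_of_nonneg hn0.le, div_mul_eq_mul_div,
    le_div_iff₀ (by positivity)] at hlo
  nlinarith

/-- The blocks at the offset `v` are eventually mutually visible, if they are so in the limit. -/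
theorem eventually_visible (hd : d ≠ 0) (hχ : 0 < χ)
    (hm : Tendsto (fun n : ℝ => (n / (m n : ℝ) ^ d) / (χ * Real.log n)) atTop (𝓝 1))
    {c : ℝ} (hc : c * χ ^ (1 / (d : ℝ)) < 1) :
    ∀ᶠ n in atTop, sideLength d n / m n * c ≤ (Real.log n) ^ (1 / (d : ℝ)) := by
  -- The strict inequality `hc` absorbs the factor `1 + o(1)` in the block volume.
  have hlim : Tendsto (fun n : ℝ => ((n / (m n : ℝ) ^ d) / (χ * Real.log n)) ^ (1 / (d : ℝ)) *
      (c * χ ^ (1 / (d : ℝ)))) atTop (𝓝 (1 ^ (1 / (d : ℝ)) * (c * χ ^ (1 / (d : ℝ))))) :=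
    (hm.rpow_const (Or.inl one_ne_zero)).mul_const _
  rw [Real.one_rpow, one_mul] at hlim
  filter_upwards [hlim.eventually (gt_mem_nhds hc), eventually_gt_atTop 1] with n hn hn1
  have hl : 0 < Real.log n := Real.log_pos hn1
  have hpow : ((m n : ℝ) ^ d) ^ (1 / (d : ℝ)) = m n := by
    rw [one_div, Real.pow_rpow_inv_natCast (by positivity) hd]
  have h1 : ((n / (m n : ℝ) ^ d) / (χ * Real.log n)) ^ (1 / (d : ℝ)) =
      sideLength d n / m n / (χ ^ (1 / (d : ℝ)) * (Real.log n) ^ (1 / (d : ℝ))) := by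
    rw [Real.div_rpow (by positivity) (by positivity), Real.div_rpow (by linarith) (by positivity),
      hpow, Real.mul_rpow hχ.le hl.le, sideLength]
  have hα : 0 < χ ^ (1 / (d : ℝ)) := Real.rpow_pos_of_pos hχ _
  have hr : 0 < (Real.log n) ^ (1 / (d : ℝ)) := Real.rpow_pos_of_pos hl _
  rw [h1] at hn
  have h2 : sideLength d n / m n / (χ ^ (1 / (d : ℝ)) * (Real.log n) ^ (1 / (d : ℝ))) *
      (c * χ ^ (1 / (d : ℝ))) = sideLength d n / m n * c / (Real.log n) ^ (1 / (d : ℝ)) := by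
    field_simp
  rw [h2, div_lt_one hr] at hn
  exact hn.le

/-- The union bound tends to zero. -/
theorem tendsto_exp_union_bound
    (hm : Tendsto (fun n : ℝ => (n / (m n : ℝ) ^ d) / (χ * Real.log n)) atTop (𝓝 1))
    {a b : ℝ} {K : ℕ} (h : 1 < K * (a * χ - b)) (C : ℝ) :
    Tendsto (fun n : ℝ => C * Real.exp (Real.log n * (1 - K *
      (a * χ * ((n / (m n : ℝ) ^ d) / (χ * Real.log n)) - b)))) atTop (𝓝 0) := by
  have h1 : Tendsto (fun n : ℝ => 1 - K *
      (a * χ * ((n / (m n : ℝ) ^ d) / (χ * Real.log n)) - b)) atTop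
      (𝓝 (1 - K * (a * χ * 1 - b))) :=
    (((hm.const_mul _).sub_const b).const_mul _).const_sub 1
  have h2 := Real.tendsto_log_atTop.atTop_mul_neg (by linarith) h1
  simpa using (Real.tendsto_exp_atBot.comp h2).const_mul C

end Asymptotics

/-! ### Assembly of the theorem -/

theorem mainTheorem4 (d : ℕ) (hd : 2 ≤ d) (lam : ℝ) (hlam : 1 < lam * unitBallVolume d) :
    ∃ δt : ℝ, 0 < δt ∧
      ∀ χ : ℝ, ChiAdmissible d lam χ →
      ∀ δ : ℝ, 0 < δ → δ < δt * χ / (unitBallVolume d * visRadius d χ ^ d) →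
      ∀ m : ℝ → ℕ,
        Tendsto (fun n : ℝ => (n / (m n : ℝ) ^ d) / (χ * Real.log n)) atTop (𝓝 1) →
      ∀ (Ω : ℝ → Type*) [∀ n, MeasurableSpace (Ω n)] (P : ∀ n, Measure (Ω n))
        [∀ n, IsProbabilityMeasure (P n)] (V : ∀ n, Ω n → Set (EuclideanSpace ℝ (Fin d))),
        (∀ n, 0 < n → IsPoissonPointProcess (P n) (region d n) lam (V n)) →
        Tendsto (fun n => P n {ω | (visibilityGraph d n (m n) δ (V n ω)).Connected})
          atTop (𝓝 1) := by
  have hl := lam_pos_of_one_lt hlam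
  have hν : 0 < unitBallVolume d := pos_of_mul_pos_right (by linarith) hl.le
  obtain ⟨t, η, ht, hη, hκ⟩ := exists_chernoff_constants (lam := lam)
    (g := (lam * unitBallVolume d - 1) / 3) hl (by linarith)
  -- Since `R_d > 2/3`, this choice turns the bound on `δ` into `δ ≤ ηχ`, with `η` independent of
  -- `χ`.
  refine ⟨η * unitBallVolume d * (2 / 3) ^ d, by positivity, ?_⟩
  intro χ hχ δ hδ hδt m hm Ω _ P _ V hV
  have hd0 : d ≠ 0 := by omega
  have hδη : δ ≤ η * χ := by
    have hR : (2 / 3 : ℝ) ^ d ≤ visRadius d χ ^ d :=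
      pow_le_pow_left₀ (by norm_num) hχ.visRadius_gt.le d
    have hR0 : 0 < visRadius d χ ^ d := lt_of_lt_of_le (by positivity) hR
    refine hδt.le.trans ?_
    rw [div_le_iff₀ (by positivity)]
    have := mul_le_mul_of_nonneg_left hR (show 0 ≤ η * χ * unitBallVolume d by
      have := hχ.pos; positivity)
    linarith
  have hα : 0 < χ ^ (1 / (d : ℝ)) := Real.rpow_pos_of_pos hχ.pos _
  set ρ : ℝ := 1 / χ ^ (1 / (d : ℝ)) with hρ
  have hρ0 : 0 ≤ ρ := by positivity
  have hunit := single_mem_visSteps hρ0 (hχ.lt_sq hd hlam)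
  obtain ⟨K, hK⟩ : ∃ K : ℕ, K + 1 = (visSteps d ρ).card :=
    ⟨_, Nat.sub_add_cancel (Finset.card_pos.2 ⟨_, hunit ⟨0, by omega⟩⟩)⟩
  have hKbound : 1 + (lam * unitBallVolume d - 1) / 3 ≤ lam * χ * K := by
    have := hχ.card_bound hd hlam
    rw [← hρ, ← hK] at this
    push_cast at this
    linarith
  -- With `κ = λ(1 - exp(-t)) - tη`, the facts `λχK ≥ 1 + g` and `κ(1 + g) > λ` give `κχK > 1`.
  have hexp : 1 < K * (lam * (1 - Real.exp (-t)) * χ - t * δ) := by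
    set g := (lam * unitBallVolume d - 1) / 3
    set κ := lam * (1 - Real.exp (-t)) - t * η with hκdef
    have hg : 0 < 1 + g := by simp only [g]; linarith
    have hκ0 : 0 < κ := pos_of_mul_pos_left (hl.trans hκ) hg.le
    have h1 := mul_le_mul_of_nonneg_left hKbound hκ0.le
    have h2 : lam * 1 < lam * (κ * (χ * K)) := by linarith
    have h3 := lt_of_mul_lt_mul_left h2 hl.le
    have h4 : κ * χ ≤ lam * (1 - Real.exp (-t)) * χ - t * δ := by
      have := mul_le_mul_of_nonneg_left hδη ht.le
      rw [hκdef]; linarith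
    have h5 := mul_le_mul_of_nonneg_left h4 (Nat.cast_nonneg (α := ℝ) K)
    linarith
  set M : ℤ := 2 * (K + ⌈ρ⌉) + 1 with hM
  set C : ℕ := ((Finset.Icc (0 : Fin d → ℤ) (fun _ => M)).powersetCard K).card with hC
  have hvis : ∀ᶠ n in atTop, ∀ v ∈ visSteps d ρ,
      sideLength d n / m n * √(∑ i, (|(v i : ℝ)| + 1) ^ 2) ≤ (Real.log n) ^ (1 / (d : ℝ)) := by
    rw [Finset.eventually_all]
    intro v hv
    refine eventually_visible hd0 hχ.pos hm ?_
    rw [mem_visSteps hρ0] at hv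
    have h1 := Real.sqrt_lt_sqrt (by positivity) hv
    rw [Real.sqrt_sq hρ0, hρ, lt_div_iff₀ hα] at h1
    exact h1
  have hlim := ENNReal.Tendsto.sub (tendsto_const_nhds (x := (1 : ℝ≥0∞)))
    (ENNReal.tendsto_ofReal (tendsto_exp_union_bound hm hexp C)) (Or.inl ENNReal.one_ne_top)
  rw [ENNReal.ofReal_zero, tsub_zero] at hlim
  refine tendsto_of_tendsto_of_tendsto_of_le_of_le' hlim tendsto_const_nhds ?_
    (Eventually.of_forall fun n => prob_le_one)
  filter_upwards [hvis, eventually_gt_atTop 1, eventually_blockCount_ne_zero hd0 hm,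
    eventually_blockCount_pow_le hχ.pos hm,
    (tendsto_blockCount hd0 hχ.pos hm).eventually_gt_atTop M.toNat] with n hvis hn hm0 hmn hmM
  have : NeZero (m n) := ⟨hm0⟩
  have hn0 : 0 < n := by linarith
  have hlog : 0 < Real.log n := Real.log_pos hn
  set q : ℝ := Real.exp (t * (δ * Real.log n) -
    lam * (n / (m n : ℝ) ^ d) * (1 - Real.exp (-t))) with hq
  have hbad := (hV n hn0).measure_exists_box_le (δ := δ) (m := m n) hn0.le
    (q := ENNReal.ofReal q) (fun k => (hV n hn0).measure_not_occupied_le hd0 hn0.le hl.le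
      ht.le k) (M := M) (by omega) K
  -- Only subadditivity is used, so neither event has to be shown measurable.
  have hcover : (1 : ℝ≥0∞) ≤ P n {ω | (visibilityGraph d n (m n) δ (V n ω)).Connected} +
      P n {ω | ∃ z : Fin d → ℤ, K ≤ (Set.Icc z (z + fun _ => M) \
        {z | OccupiedBlock d n (m n) δ (V n ω) (torusIndex (m n) z)}).ncard} := by
    rw [← measure_univ (μ := P n)]
    refine (measure_mono fun ω _ => ?_).trans (measure_union_le _ _)
    by_cases hω : ∃ z : Fin d → ℤ, K ≤ (Set.Icc z (z + fun _ => M) \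
        {z | OccupiedBlock d n (m n) δ (V n ω) (torusIndex (m n) z)}).ncard
    · exact Or.inr hω
    · left
      push Not at hω
      obtain ⟨hne, hconn⟩ := lattice_connected hd (isSolidSet_visSteps hρ0) hunit
        (fun v hv => abs_le_of_mem_visSteps hv) hK hω
      exact visibilityGraph_connected hn0.le hvis rfl hne hconn
  refine tsub_le_iff_right.2 (hcover.trans (add_le_add_right (hbad.trans ?_) _))
  rw [← ENNReal.ofReal_natCast, ← ENNReal.ofReal_natCast C, ← ENNReal.ofReal_pow (by positivity),
    ← ENNReal.ofReal_pow (by positivity), ← ENNReal.ofReal_mul (by positivity),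
    ← ENNReal.ofReal_mul (by positivity)]
  refine ENNReal.ofReal_le_ofReal ?_
  have hqK : n * q ^ K = Real.exp (Real.log n * (1 - K * (lam * (1 - Real.exp (-t)) * χ *
      ((n / (m n : ℝ) ^ d) / (χ * Real.log n)) - t * δ))) := by
    nth_rewrite 1 [← Real.exp_log hn0]
    rw [hq, ← Real.exp_nat_mul, ← Real.exp_add]
    congr 1
    have := hχ.pos
    field_simp
    ring
  rw [← hqK]
  have := mul_le_mul_of_nonneg_right hmn (show 0 ≤ C * q ^ K by positivity)
  linarith
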